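/- Let $X$ be a Polish space with its Borel $\sigma$-field, $(\Theta,\mathcal T)$ a measurable space, $\{P_\theta,\theta\in\Theta\}$ a family of Markov transition kernels on $X$, and $\{\theta_n,n\ge 0\}$ a sequence of $\Theta$-valued random variables on a probability space $(\Omega,\mathcal A,\mathbb P)$. Write $Pf(x)=\int f(y)\,P(x,dy)$, and let $C_b(X)$ be the set of bounded continuous functions $X\to\mathbb R$. Assume (A3): there are a nonzero $\sigma$-finite measure $\pi$ on $X$ and a measurable function $V:X\to[1,\infty)$ such that every $P_\theta$ is $\pi$-irreducible and aperiodic, and for every $\theta\in\Theta$ there are constants $b_\theta<\infty$, $\delta_\theta\in(0,1)$, $\lambda_\theta\in(0,1)$ and a probability measure $\nu_\theta$ on $X$ with $$P_\theta V\le\lambda_\theta V+b_\theta,\qquad P_\theta(x,\cdot)\ge\delta_\theta\,\nu_\theta(\cdot)\,\mathbf 1_{\{V\le c_\theta\}}(x),\qquad c_\theta:=2b_\theta(1-\lambda_\theta)^{-1}-1 .$$ Let $\pi_\theta$ denote the invariant probability measure of $P_\theta$ (that is, $\pi_\theta P_\theta=\pi_\theta$). For measures put $\|\mu_1-\mu_2\|_V=\sup\{|\mu_1(f)-\mu_2(f)|: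 f \text{ measurable},\ |f|\le V\}$, and let $$L_\theta:=\inf\bigl\{C\vee(1-\rho)^{-1}:\ C\in\mathbb R,\ \rho\in(0,1),\ \|P_\theta^n(x,\cdot)-\pi_\theta\|_V\le C\rho^nV(x)\ \text{for all } n\ge0,\ x\in X\bigr\}\in[0,\infty],$$ with $L_\theta=\infty$ if there is no such pair $(C,\rho)$ or no invariant probability measure. Assume further: (i) $\limsup_{n\to\infty}L_{\theta_n}<\infty$ $\mathbb P$-almost surely; (ii) for every $f\in C_b(X)$ the family $\{P_\theta f,\theta\in\Theta\}$ is equicontinuous; (iii) there is $\theta_\star\in\Theta$ such that for every $x\in X$, for $\mathbb P$-almost every $\omega$, the measures $P_{\theta_n(\omega)}(x,\cdot)$ converge weakly to $P_{\theta_\star}(x,\cdot)$ as $n\to\infty$. Then $P_{\theta_\star}$ has exactly one invariant probability measure $\pi_{\theta_\star}$, and there is a measurable set $\Omega_0$ with $\mathbb P(\Omega_0)=1$ such that for every $\omega\in\Omega_0$ the kernel $P_{\theta_n(\omega)}$ has exactly one invariant probability measure for all large $n$, and $$\pi_{\theta_n(\omega)}(f)\to\pi_{\theta_\star}(f)\qquad\text{for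 all } f\in C_b(X),$$ i.e. $\pi_{\theta_n(\omega)}$ converges weakly to $\pi_{\theta_\star}$. -/

import Mathlib

open MeasureTheory ProbabilityTheory Filter Topology
open scoped ENNReal BoundedContinuousFunction

namespace AdaptiveMCMC

noncomputable section

variable {X : Type*} [MeasurableSpace X]

/-- `μ` is a probability measure with `μ P = μ`. -/
def IsInvariantProb (P : Kernel X X) (μ : Measure X) : Prop :=
  IsProbabilityMeasure μ ∧ P.Invariant μ

/-- `μ` is the one and only invariant probability measure of `P`. -/
def IsUniqueInvariantProb (P : Kernel X X) (μ : Measure X) : Prop :=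
  IsInvariantProb P μ ∧ ∀ μ' : Measure X, IsInvariantProb P μ' → μ' = μ

open Classical in
/-- The invariant probability measure of `P` (the zero measure if there is none). -/
def invProb (P : Kernel X X) : Measure X :=
  if h : ∃ μ : Measure X, IsInvariantProb P μ then h.choose else 0

/-- Aperiodicity of an irreducible kernel: there is no cycle of `d ≥ 2` pairwise disjoint
nonempty measurable sets `D 0 → D 1 → ⋯ → D (d - 1) → D 0`. (The union of such a cycle is
absorbing, so for an irreducible kernel its complement is automatically null.) -/
def IsAperiodic (P : Kernel X X) : Prop :=
  ∀ d : ℕ, 2 ≤ d → ¬ ∃ D : ZMod d → Set X,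
    (∀ i, MeasurableSet (D i)) ∧ (∀ i, (D i).Nonempty) ∧
    (∀ i j, i ≠ j → Disjoint (D i) (D j)) ∧
    ∀ i, ∀ x ∈ D i, P x (D (i + 1)) = 1

/-- The `V`-distance of two measures: the supremum of `|μ₁(f) - μ₂(f)|` over the measurable
`f` with `|f| ≤ V`. -/
def vDist (V : X → ℝ) (μ₁ μ₂ : Measure X) : ℝ≥0∞ :=
  ⨆ (f : X → ℝ) (_ : Measurable f) (_ : ∀ x, |f x| ≤ V x),
    ENNReal.ofReal |(∫ x, f x ∂μ₁) - ∫ x, f x ∂μ₂|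

/-- `C` and `ρ` are constants of geometric ergodicity of `P` in the `V`-norm:
`ρ ∈ (0,1)` and `‖P ^ n (x, ·) - π_P‖_V ≤ C ρ ^ n V(x)` for all `n` and `x`, where `π_P` is the
invariant probability measure of `P`. -/
def IsErgodicityConst (V : X → ℝ) (P : Kernel X X) (C ρ : ℝ) : Prop :=
  ρ ∈ Set.Ioo (0 : ℝ) 1 ∧
    ∀ (n : ℕ) (x : X), vDist V ((P ^ n) x) (invProb P) ≤ ENNReal.ofReal (C * ρ ^ n * V x)

/-- `L = C ∨ (1 - ρ)⁻¹` for the best constants `C`, `ρ` of geometric ergodicity: the infimum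
over all admissible pairs, `∞` if there is none. It is at most the value of `C ∨ (1 - ρ)⁻¹` for
any particular choice of admissible constants. -/
def ergL (V : X → ℝ) (P : Kernel X X) : ℝ≥0∞ :=
  ⨅ (C : ℝ) (ρ : ℝ) (_ : IsErgodicityConst V P C ρ), ENNReal.ofReal (max C (1 - ρ)⁻¹)

/-- The simultaneous geometric drift and minorization condition, for the irreducibility measure
`π` and the drift function `V`. -/
structure DriftMinorization {Θ : Type*} (π : Measure X) (V : X → ℝ) (P : Θ → Kernel X X) :
    Prop where
  irreducible : ∀ θ, (P θ).IsIrreducible π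
  aperiodic : ∀ θ, IsAperiodic (P θ)
  measurable_V : Measurable V
  one_le_V : ∀ x, 1 ≤ V x
  drift_minorization : ∀ θ, ∃ (b δ lam : ℝ) (ν : Measure X),
    δ ∈ Set.Ioo (0 : ℝ) 1 ∧ lam ∈ Set.Ioo (0 : ℝ) 1 ∧ IsProbabilityMeasure ν ∧
    (∀ x, ∫⁻ y, ENNReal.ofReal (V y) ∂(P θ x) ≤ ENNReal.ofReal (lam * V x + b)) ∧
    ∀ x, V x ≤ 2 * b * (1 - lam)⁻¹ - 1 →
      ∀ A, MeasurableSet A → ENNReal.ofReal δ * ν A ≤ P θ x A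

end

end AdaptiveMCMC

/-! Fix a good `ω` and write `Q n` for the kernel at `θ n ω` and `R` for the kernel at `θstar`. A
bound `K` on `ergL` for large `n` gives one rate, `‖f‖ * (K * (1 - K⁻¹) ^ k * V x)`, at which `Q n ^
k` forgets its starting point, the same for all those `n`.

Equicontinuity carries weak convergence from `Q n` to its iterates (`tendsto_integral_pow`). Any two
iterates of `R` can then be compared through the invariant measure of `Q n`, which cancels as `n →
∞`. So the iterates of `R` inherit a geometric Cauchy estimate, although nothing is assumed about
`ergL` at `θstar`.

That estimate is uniform over `‖f‖ ≤ 1`, hence holds in total variation, and completeness produces a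
limit law `m` without any tightness argument. The Feller property makes `m` invariant, and
convergence from every starting point makes it unique. Finally the limits in `k` and `n` are
exchanged, which the uniform rate permits. -/

namespace AdaptiveMCMC

/-! ### Suprema of equicontinuous families; completeness in total variation. -/

section TotalVariation

/-- The pointwise supremum of a uniformly bounded equicontinuous family is continuous. -/
theorem continuous_iSup_of_equicontinuous {X ι : Type*} [TopologicalSpace X] [Nonempty ι]
    {F : ι → X → ℝ} (hF : Equicontinuous F) {M : ℝ} (hM : ∀ i x, F i x ≤ M) :
    Continuous fun x => ⨆ i, F i x := by
  have hb : ∀ x, BddAbove (Set.range fun i => F i x) := fun x =>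
    ⟨M, by rintro _ ⟨i, rfl⟩; exact hM i x⟩
  rw [continuous_iff_continuousAt]
  intro x
  rw [ContinuousAt, Metric.tendsto_nhds]
  intro ε hε
  filter_upwards [Metric.equicontinuousAt_iff_right.1 (hF x) (ε / 2) (by positivity)] with y hy
  have h1 : (⨆ i, F i x) ≤ (⨆ i, F i y) + ε / 2 := ciSup_le fun i => by
    have := abs_lt.1 (hy i)
    have := le_ciSup (hb y) i
    linarith
  have h2 : (⨆ i, F i y) ≤ (⨆ i, F i x) + ε / 2 := ciSup_le fun i => by
    have := abs_lt.1 (hy i)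
    have := le_ciSup (hb x) i
    linarith
  rw [Real.dist_eq, abs_lt]
  constructor <;> linarith

/-- Finite measures whose integrals against all bounded continuous functions are close
are close on all measurable sets. -/
theorem abs_measureReal_sub_le_of_forall_integral {X : Type*} [TopologicalSpace X]
    [PolishSpace X] [MeasurableSpace X] [BorelSpace X] {μ ν : Measure X}
    [IsFiniteMeasure μ] [IsFiniteMeasure ν] {ε : ℝ} (hε : 0 ≤ ε)
    (h : ∀ f : X →ᵇ ℝ, |∫ x, f x ∂μ - ∫ x, f x ∂ν| ≤ ‖f‖ * ε)
    {A : Set X} (hA : MeasurableSet A) : |μ.real A - ν.real A| ≤ ε := by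
  let _ := TopologicalSpace.upgradeIsCompletelyMetrizable X
  have hclosed : ∀ F : Set X, IsClosed F → |μ.real F - ν.real F| ≤ ε := by
    intro F hF
    -- Thickened indicators are continuous with norm at most 1 and decrease to the indicator of a
    -- closed set.
    have hpos : ∀ n : ℕ, 0 < 1 / ((n : ℝ) + 1) := fun n => Nat.one_div_pos_of_nat
    have key := fun (ρ : Measure X) (_ : IsFiniteMeasure ρ) =>
      tendsto_integral_thickenedIndicator_of_isClosed ρ hF hpos
        tendsto_one_div_add_atTop_nhds_zero_nat
    refine le_of_tendsto ((key μ inferInstance).sub (key ν inferInstance)).abs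
      (Eventually.of_forall fun n => ?_)
    let f : X →ᵇ ℝ := BoundedContinuousFunction.ofNormedAddCommGroup
      (fun x => (thickenedIndicator (hpos n) F x : ℝ)) (by fun_prop) 1
      (fun x => by simpa using thickenedIndicator_le_one (hpos n) F x)
    have hf : ‖f‖ ≤ 1 := BoundedContinuousFunction.norm_ofNormedAddCommGroup_le _ zero_le_one _
    exact (h f).trans (by nlinarith)
  refine le_of_forall_pos_le_add fun η hη => ?_
  -- Inner regularity of the sum `μ + ν` yields one closed set that works for both measures.
  obtain ⟨F, hFA, hF, hμF⟩ := hA.exists_isClosed_sdiff_lt (μ := μ + ν) (by finiteness)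
    (ε := ENNReal.ofReal η) (by simpa using hη)
  have hsum : μ.real (A \ F) + ν.real (A \ F) ≤ η := by
    rw [← measureReal_add_apply]
    exact ENNReal.toReal_le_of_le_ofReal hη.le hμF.le
  have e1 := measureReal_sdiff (μ := μ) hFA hF.measurableSet
  have e2 := measureReal_sdiff (μ := ν) hFA hF.measurableSet
  have p1 : 0 ≤ μ.real (A \ F) := measureReal_nonneg
  have p2 : 0 ≤ ν.real (A \ F) := measureReal_nonneg
  have := abs_le.1 (hclosed F hF)
  rw [abs_le]
  constructor <;> linarith

/-- A sequence of probability measures that is uniformly Cauchy on measurable sets converges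
on measurable sets to a probability measure. -/
theorem exists_tendsto_measureReal {X : Type*} [MeasurableSpace X] (μ : ℕ → Measure X)
    [∀ k, IsProbabilityMeasure (μ k)] {e : ℕ → ℝ} (he : Tendsto e atTop (𝓝 0))
    (h : ∀ A, MeasurableSet A → ∀ k l N, N ≤ k → N ≤ l →
      |(μ k).real A - (μ l).real A| ≤ e N) :
    ∃ m : Measure X, IsProbabilityMeasure m ∧
      ∀ A, MeasurableSet A → Tendsto (fun k => (μ k).real A) atTop (𝓝 (m.real A)) := by
  have hex : ∀ A, ∃ a, MeasurableSet A → Tendsto (fun k => (μ k).real A) atTop (𝓝 a) := by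
    intro A
    by_cases hA : MeasurableSet A
    · obtain ⟨a, ha⟩ := cauchySeq_tendsto_of_complete (cauchySeq_of_le_tendsto_0
        (s := fun k => (μ k).real A) e (h A hA) he)
      exact ⟨a, fun _ => ha⟩
    · exact ⟨0, fun h => absurd h hA⟩
  choose a ha using hex
  have hnn : ∀ A, MeasurableSet A → 0 ≤ a A := fun A hA =>
    ge_of_tendsto' (ha A hA) fun _ => measureReal_nonneg
  have hle : ∀ A, MeasurableSet A → ∀ k, |(μ k).real A - a A| ≤ e k := fun A hA k =>
    le_of_tendsto (tendsto_const_nhds.sub (ha A hA)).abs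
      ((eventually_ge_atTop k).mono fun l hl => h A hA k l k le_rfl hl)
  have hsum : ∀ f : ℕ → Set X, (∀ i, MeasurableSet (f i)) → Pairwise (Function.onFun Disjoint f) →
      HasSum (fun i => a (f i)) (a (⋃ i, f i)) := by
    intro f hf hd
    rw [hasSum_iff_tendsto_nat_of_nonneg fun i => hnn _ (hf i)]
    have hfin : ∀ k N, (μ k).real (⋃ i ∈ Finset.range N, f i)
        = ∑ i ∈ Finset.range N, (μ k).real (f i) := fun k N =>
      measureReal_biUnion_finset (fun i _ j _ hij => hd hij) fun i _ => hf i
    have hm : ∀ N, MeasurableSet (⋃ i ∈ Finset.range N, f i) := fun N =>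
      Finset.measurableSet_biUnion _ fun i _ => hf i
    have hafin : ∀ N, a (⋃ i ∈ Finset.range N, f i) = ∑ i ∈ Finset.range N, a (f i) := by
      intro N
      refine tendsto_nhds_unique (ha _ (hm N)) ?_
      simp_rw [hfin]
      exact tendsto_finsetSum _ fun i _ => ha _ (hf i)
    -- Countable additivity of the limit is an exchange of limits: the error `e k` does not depend
    -- on the set, so the partial sums converge uniformly in `N`.
    refine TendstoUniformly.tendsto_of_eventually_tendsto (p := atTop)
      (F := fun k N => ∑ i ∈ Finset.range N, (μ k).real (f i)) ?_
      (Eventually.of_forall fun k => ?_) (ha _ (MeasurableSet.iUnion hf))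
    · rw [Metric.tendstoUniformly_iff]
      intro ε hε
      filter_upwards [he.eventually_lt_const hε] with k hk N
      rw [← hafin, ← hfin, dist_comm]
      exact (hle _ (hm N) k).trans_lt hk
    · refine (HasSum.tendsto_sum_nat ?_)
      have := ENNReal.summable_toReal (f := fun i => μ k (f i))
        (by rw [← measure_iUnion hd hf]; finiteness)
      rw [measureReal_def, measure_iUnion hd hf, ENNReal.tsum_toReal_eq fun i => by finiteness]
      exact this.hasSum
  have h0 : a ∅ = 0 := tendsto_nhds_unique (ha ∅ .empty) (by simp)
  have h1 : a Set.univ = 1 := tendsto_nhds_unique (ha _ .univ) (by simp)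
  let m : Measure X := Measure.ofMeasurable (fun A _ => ENNReal.ofReal (a A)) (by simp [h0])
    fun f hf hd => by
      rw [← (hsum f hf hd).tsum_eq,
        ENNReal.ofReal_tsum_of_nonneg (fun i => hnn _ (hf i)) (hsum f hf hd).summable]
  have hmA : ∀ A, MeasurableSet A → m A = ENNReal.ofReal (a A) := fun A hA =>
    Measure.ofMeasurable_apply A hA
  refine ⟨m, ⟨by simp [hmA _ .univ, h1]⟩, fun A hA => ?_⟩
  rw [measureReal_def, hmA A hA, ENNReal.toReal_ofReal (hnn A hA)]
  exact ha A hA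

/-- Convergence on measurable sets implies weak convergence. -/
theorem tendsto_integral_of_tendsto_measureReal {X : Type*} [TopologicalSpace X]
    [MeasurableSpace X] [OpensMeasurableSpace X] {μ : ℕ → Measure X}
    [∀ k, IsProbabilityMeasure (μ k)] {m : Measure X} [IsProbabilityMeasure m]
    (h : ∀ A, MeasurableSet A → Tendsto (fun k => (μ k).real A) atTop (𝓝 (m.real A)))
    (f : X →ᵇ ℝ) : Tendsto (fun k => ∫ x, f x ∂(μ k)) atTop (𝓝 (∫ x, f x ∂m)) := by
  let μ' : ℕ → ProbabilityMeasure X := fun k => ⟨μ k, inferInstance⟩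
  let m' : ProbabilityMeasure X := ⟨m, inferInstance⟩
  have : Tendsto μ' atTop (𝓝 m') := tendsto_of_forall_isOpen_le_liminf fun G hG => by
    have : Tendsto (fun k => μ' k G) atTop (𝓝 (m' G)) := by
      rw [← NNReal.tendsto_coe]
      exact h G hG.measurableSet
    exact this.liminf_eq.ge
  exact ProbabilityMeasure.tendsto_iff_forall_integral_tendsto.1 this f

end TotalVariation

/-! ### Iterates of Markov kernels and weak convergence. -/

section Kernels

variable {X : Type*} [MeasurableSpace X]

instance isMarkovKernel_pow (κ : Kernel X X) [IsMarkovKernel κ] (k : ℕ) :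
    IsMarkovKernel (κ ^ k) := by
  induction k with
  | zero => exact inferInstanceAs (IsMarkovKernel Kernel.id)
  | succ k ih => rw [pow_succ']; exact inferInstanceAs (IsMarkovKernel (κ ∘ₖ (κ ^ k)))

theorem invariant_pow {κ : Kernel X X} {μ : Measure X} (h : κ.Invariant μ) (k : ℕ) :
    (κ ^ k).Invariant μ := by
  induction k with
  | zero => exact Measure.bind_dirac
  | succ k ih => rw [pow_succ']; exact h.comp ih

variable [TopologicalSpace X] [OpensMeasurableSpace X]

theorem integral_pow_succ (κ : Kernel X X) [IsMarkovKernel κ] (k : ℕ) (x : X) (f : X →ᵇ ℝ) :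
    ∫ y, f y ∂((κ ^ (k + 1)) x) = ∫ z, ∫ y, f y ∂(κ z) ∂((κ ^ k) x) := by
  rw [pow_succ']
  exact Kernel.integral_comp (κ := κ ^ k) (η := κ)
    (BoundedContinuousFunction.integrable ((κ ∘ₖ (κ ^ k)) x) f)

theorem integral_bind_kernel (κ : Kernel X X) [IsMarkovKernel κ] (μ : Measure X)
    [IsProbabilityMeasure μ] (f : X →ᵇ ℝ) :
    ∫ y, f y ∂(μ.bind κ) = ∫ x, ∫ y, f y ∂(κ x) ∂μ := by
  have := Kernel.integral_comp (κ := Kernel.const Unit μ) (η := κ) (a := ()) (f := f)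
    (BoundedContinuousFunction.integrable _ f)
  rwa [Kernel.comp_const, Kernel.const_apply, Kernel.const_apply] at this

theorem abs_integral_le_norm (μ : Measure X) [IsProbabilityMeasure μ] (f : X →ᵇ ℝ) :
    |∫ y, f y ∂μ| ≤ ‖f‖ := by
  simpa using f.norm_integral_le_norm μ

/-- If the laws of a Markov chain converge weakly to `m` from every starting point, then `m` is
the only candidate for an invariant probability measure. -/
theorem eq_of_isInvariantProb [HasOuterApproxClosed X] [BorelSpace X] {κ : Kernel X X}
    [IsMarkovKernel κ] {m μ : Measure X} [IsProbabilityMeasure m]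
    (h : ∀ x, ∀ f : X →ᵇ ℝ, Tendsto (fun k => ∫ y, f y ∂((κ ^ k) x)) atTop (𝓝 (∫ y, f y ∂m)))
    (hμ : IsInvariantProb κ μ) : μ = m := by
  obtain ⟨_, hinv⟩ := hμ
  refine ext_of_forall_integral_eq_of_IsFiniteMeasure fun f => ?_
  have hk : ∀ k : ℕ, ∫ x, ∫ y, f y ∂((κ ^ k) x) ∂μ = ∫ x, f x ∂μ := fun k => by
    rw [← integral_bind_kernel, (invariant_pow hinv k).def]
  have hlim : Tendsto (fun k : ℕ => ∫ x, ∫ y, f y ∂((κ ^ k) x) ∂μ) atTop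
      (𝓝 (∫ _, ∫ y, f y ∂m ∂μ)) :=
    tendsto_integral_of_dominated_convergence (fun _ => ‖f‖)
      (fun k => (f.continuous.stronglyMeasurable.integral_kernel).aestronglyMeasurable)
      (integrable_const _) (fun k => ae_of_all _ fun x => abs_integral_le_norm _ f)
      (ae_of_all _ fun x => h x f)
  simp only [hk, integral_const, probReal_univ, one_smul] at hlim
  exact tendsto_nhds_unique tendsto_const_nhds hlim

/-- Integrals of an equicontinuous bounded sequence tending pointwise to zero, against a weakly
convergent sequence of probability measures, tend to zero. -/
theorem tendsto_integral_zero_of_equicontinuous {μ : ℕ → Measure X}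
    [∀ n, IsProbabilityMeasure (μ n)] {m : Measure X} [IsProbabilityMeasure m]
    (hμ : ∀ f : X →ᵇ ℝ, Tendsto (fun n => ∫ y, f y ∂(μ n)) atTop (𝓝 (∫ y, f y ∂m)))
    {D : ℕ → X → ℝ} (hD : Equicontinuous D) {M : ℝ} (hM : ∀ n x, |D n x| ≤ M)
    (h0 : ∀ x, Tendsto (fun n => D n x) atTop (𝓝 0)) :
    Tendsto (fun n => ∫ y, D n y ∂(μ n)) atTop (𝓝 0) := by
  -- The tail supremum `u N` is a single bounded continuous function dominating `|D n|` for all `n ≥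
  -- N`. It can thus be tested against `μ n` with `N` fixed, and its `m`-integral is small for large
  -- `N`.
  let u : ℕ → X → ℝ := fun N x => ⨆ i, |D (N + i) x|
  have hb : ∀ N x, BddAbove (Set.range fun i => |D (N + i) x|) := fun N x =>
    ⟨M, by rintro _ ⟨i, rfl⟩; exact hM _ x⟩
  have hu0 : ∀ N x, 0 ≤ u N x := fun N x => Real.iSup_nonneg fun i => abs_nonneg _
  have huM : ∀ N x, u N x ≤ M := fun N x => ciSup_le fun i => hM _ x
  have huc : ∀ N, Continuous (u N) := fun N => by
    refine continuous_iSup_of_equicontinuous (fun x => ?_) fun i x => hM (N + i) x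
    rw [Metric.equicontinuousAt_iff_right]
    intro ε hε
    filter_upwards [Metric.equicontinuousAt_iff_right.1 (hD x) ε hε] with y hy i
    exact (abs_abs_sub_abs_le_abs_sub _ _).trans_lt (hy (N + i))
  let U : ℕ → X →ᵇ ℝ := fun N => BoundedContinuousFunction.ofNormedAddCommGroup (u N) (huc N) M
    fun x => by rw [Real.norm_eq_abs, abs_of_nonneg (hu0 N x)]; exact huM N x
  have hulim : ∀ x, Tendsto (fun N => u N x) atTop (𝓝 0) := by
    intro x
    rw [Metric.tendsto_atTop]
    intro ε hε
    obtain ⟨N, hN⟩ := Metric.tendsto_atTop.1 (h0 x) (ε / 2) (by positivity)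
    refine ⟨N, fun n hn => ?_⟩
    have : u n x ≤ ε / 2 := ciSup_le fun i => by
      simpa using (hN (n + i) (by omega)).le
    rw [Real.dist_eq, sub_zero, abs_of_nonneg (hu0 n x)]
    linarith
  have hUlim : Tendsto (fun N => ∫ y, U N y ∂m) atTop (𝓝 0) := by
    have := tendsto_integral_of_dominated_convergence (μ := m) (F := u) (f := fun _ => 0)
      (fun _ => M) (fun N => (huc N).aestronglyMeasurable) (integrable_const _)
      (fun N => ae_of_all _ fun x => by
        rw [Real.norm_eq_abs, abs_of_nonneg (hu0 N x)]; exact huM N x)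
      (ae_of_all _ hulim)
    rwa [integral_zero] at this
  rw [Metric.tendsto_nhds]
  intro ε hε
  obtain ⟨N, hN⟩ := (hUlim.eventually_lt_const hε).exists
  filter_upwards [(hμ (U N)).eventually_lt_const hN, eventually_ge_atTop N] with n hn hNn
  rw [dist_zero_right]
  refine (norm_integral_le_of_norm_le (BoundedContinuousFunction.integrable _ (U N))
    (ae_of_all _ fun x => ?_)).trans_lt hn
  obtain ⟨i, rfl⟩ := Nat.exists_eq_add_of_le hNn
  exact le_ciSup (hb N x) i

/-- Under equicontinuity, weak convergence of transition kernels passes to their iterates. -/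
theorem tendsto_integral_pow {Q : ℕ → Kernel X X} [∀ n, IsMarkovKernel (Q n)] {R : Kernel X X}
    [IsMarkovKernel R]
    (hequi : ∀ f : X →ᵇ ℝ, Equicontinuous fun (n : ℕ) (x : X) => ∫ y, f y ∂(Q n x))
    (hfeller : ∀ f : X →ᵇ ℝ, Continuous fun x => ∫ y, f y ∂(R x))
    (hconv : ∀ x, ∀ f : X →ᵇ ℝ,
      Tendsto (fun n => ∫ y, f y ∂(Q n x)) atTop (𝓝 (∫ y, f y ∂(R x))))
    (k : ℕ) (x : X) (f : X →ᵇ ℝ) :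
    Tendsto (fun n => ∫ y, f y ∂((Q n ^ k) x)) atTop (𝓝 (∫ y, f y ∂((R ^ k) x))) := by
  induction k generalizing f with
  | zero => simp
  | succ k ih =>
    let g : X →ᵇ ℝ := BoundedContinuousFunction.ofNormedAddCommGroup
      (fun x => ∫ y, f y ∂(R x)) (hfeller f) ‖f‖ fun x => abs_integral_le_norm _ f
    have hcont : ∀ n, Continuous fun x => ∫ y, f y ∂(Q n x) := (hequi f).continuous
    -- Integrand and measure both vary with `n`. Subtracting `g`, the image of `f` under `R`, leaves
    -- an equicontinuous error tending to zero; the integral of the fixed `g` is handled by the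
    -- induction hypothesis.
    have hdiff : Tendsto (fun n => ∫ z, (∫ y, f y ∂(Q n z) - g z) ∂((Q n ^ k) x)) atTop
        (𝓝 0) := by
      refine tendsto_integral_zero_of_equicontinuous ih (M := ‖f‖ + ‖f‖)
        (D := fun n z => ∫ y, f y ∂(Q n z) - g z) (fun z => ?_) (fun n z => ?_) fun z => ?_
      · rw [Metric.equicontinuousAt_iff_right]
        intro ε hε
        filter_upwards [Metric.equicontinuousAt_iff_right.1 (hequi f z) (ε / 2) (by positivity),
          Metric.tendsto_nhds.1 (g.continuous.tendsto z) (ε / 2) (by positivity)] with w h1 h2 n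
        have := (dist_sub_sub_le (∫ y, f y ∂(Q n z)) (g z) (∫ y, f y ∂(Q n w)) (g w))
        have := h1 n
        rw [dist_comm] at h2
        linarith
      · exact (abs_sub _ _).trans
          (add_le_add (abs_integral_le_norm _ f) (abs_integral_le_norm _ f))
      · have := (hconv z f).sub_const (g z)
        rwa [show ∫ y, f y ∂(R z) - g z = 0 from sub_self _] at this
    simp_rw [integral_pow_succ]
    have := hdiff.add (ih g)
    rw [zero_add] at this
    refine this.congr fun n => ?_
    rw [← integral_add]
    · simp
    · refine Integrable.sub ?_ (BoundedContinuousFunction.integrable _ g)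
      exact Integrable.of_bound (hcont n).aestronglyMeasurable ‖f‖
        (ae_of_all _ fun z => abs_integral_le_norm _ f)
    · exact BoundedContinuousFunction.integrable _ g

end Kernels

/-! ### Geometric ergodicity and invariant measures. -/

section InvariantMeasures

theorem IsUniqueInvariantProb.invProb_eq {X : Type*} [MeasurableSpace X] {κ : Kernel X X}
    {m : Measure X} (h : IsUniqueInvariantProb κ m) : invProb κ = m := by
  have hex : ∃ μ, IsInvariantProb κ μ := ⟨m, h.1⟩
  rw [invProb, dif_pos hex]
  exact h.2 _ hex.choose_spec

variable {X : Type*} [TopologicalSpace X] [MeasurableSpace X] [OpensMeasurableSpace X]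

/-- Since `1 ≤ V`, the rescaled function `‖f‖⁻¹ * f` is admissible in the supremum defining `vDist`.
-/
theorem abs_integral_sub_le_of_vDist_le {V : X → ℝ} (hV : ∀ x, 1 ≤ V x) {μ ν : Measure X}
    {c : ℝ} (hc : 0 ≤ c) (h : vDist V μ ν ≤ ENNReal.ofReal c) (f : X →ᵇ ℝ) :
    |∫ x, f x ∂μ - ∫ x, f x ∂ν| ≤ ‖f‖ * c := by
  rcases eq_or_ne f 0 with rfl | hf
  · simp
  have hpos : 0 < ‖f‖ := norm_pos_iff.2 hf
  have hle : ENNReal.ofReal |∫ x, ‖f‖⁻¹ * f x ∂μ - ∫ x, ‖f‖⁻¹ * f x ∂ν| ≤ ENNReal.ofReal c := by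
    refine le_trans ?_ h
    refine le_iSup_of_le (fun x => ‖f‖⁻¹ * f x) (le_iSup_of_le
      (by fun_prop) (le_iSup_of_le (fun x => ?_) le_rfl))
    rw [abs_mul, abs_inv, abs_norm, inv_mul_le_iff₀ hpos]
    nlinarith [f.norm_coe_le_norm x, hV x, Real.norm_eq_abs (f x)]
  rw [ENNReal.ofReal_le_ofReal_iff hc, integral_const_mul, integral_const_mul, ← mul_sub, abs_mul,
    abs_inv, abs_norm, inv_mul_le_iff₀ hpos] at hle
  exact hle

/-- A bound on `ergL` yields explicit constants of geometric ergodicity. -/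
theorem abs_integral_pow_sub_invProb_le {V : X → ℝ} (hV : ∀ x, 1 ≤ V x) {κ : Kernel X X} {K : ℝ}
    (hK : 1 ≤ K) (h : ergL V κ < ENNReal.ofReal K) (k : ℕ) (x : X) (f : X →ᵇ ℝ) :
    |∫ y, f y ∂((κ ^ k) x) - ∫ y, f y ∂(invProb κ)| ≤ ‖f‖ * (K * (1 - K⁻¹) ^ k * V x) := by
  simp only [ergL, iInf_lt_iff] at h
  obtain ⟨C, ρ, ⟨⟨hρ0, hρ1⟩, hb⟩, hlt⟩ := h
  have hlt' := (ENNReal.ofReal_lt_ofReal_iff (by linarith)).1 hlt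
  have hC : C ≤ K := (le_max_left _ _).trans hlt'.le
  have hρ : ρ ≤ 1 - K⁻¹ := by
    have : (1 - ρ)⁻¹ ≤ K := (le_max_right _ _).trans hlt'.le
    have := inv_le_of_inv_le₀ (by linarith) this
    linarith
  have hVx : 0 ≤ V x := zero_le_one.trans (hV x)
  have hr : 0 ≤ 1 - K⁻¹ := hρ0.le.trans hρ
  refine abs_integral_sub_le_of_vDist_le hV (by positivity)
    ((hb k x).trans (ENNReal.ofReal_le_ofReal ?_)) f
  gcongr

variable [BorelSpace X]

/-- A kernel with finite `ergL` has exactly one invariant probability measure. -/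
theorem isUniqueInvariantProb_invProb [HasOuterApproxClosed X] [Nonempty X] {V : X → ℝ}
    (hV : ∀ x, 1 ≤ V x) {κ : Kernel X X} [IsMarkovKernel κ] {K : ℝ} (hK : 1 ≤ K)
    (h : ergL V κ < ENNReal.ofReal K) : IsUniqueInvariantProb κ (invProb κ) := by
  have hlim : ∀ x, ∀ f : X →ᵇ ℝ,
      Tendsto (fun k => ∫ y, f y ∂((κ ^ k) x)) atTop (𝓝 (∫ y, f y ∂(invProb κ))) := by
    intro x f
    have hKi : K⁻¹ ≤ 1 := inv_le_one_of_one_le₀ hK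
    have hKp : 0 < K⁻¹ := by positivity
    have h0 : Tendsto (fun k : ℕ => ‖f‖ * (K * (1 - K⁻¹) ^ k * V x)) atTop (𝓝 0) := by
      simpa using (((tendsto_pow_atTop_nhds_zero_of_lt_one (r := 1 - K⁻¹) (by linarith)
        (by linarith)).const_mul K).mul_const (V x)).const_mul ‖f‖
    exact tendsto_iff_dist_tendsto_zero.2 (squeeze_zero (fun _ => dist_nonneg)
      (fun k => abs_integral_pow_sub_invProb_le hV hK h k x f) h0)
  have hex : ∃ μ, IsInvariantProb κ μ := by
    -- Without an invariant measure `invProb κ` defaults to `0`, and testing on the constant `1`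
    -- would give `1 = 0`.
    by_contra hno
    have hz : invProb κ = 0 := dif_neg hno
    obtain ⟨x⟩ := ‹Nonempty X›
    have := hlim x (BoundedContinuousFunction.const X 1)
    simp only [BoundedContinuousFunction.const_apply, integral_const, probReal_univ, smul_eq_mul,
      mul_one, hz, measureReal_zero_apply] at this
    exact one_ne_zero (tendsto_nhds_unique tendsto_const_nhds this)
  have hinv : IsInvariantProb κ (invProb κ) := by
    rw [invProb, dif_pos hex]
    exact hex.choose_spec
  have := hinv.1
  exact ⟨hinv, fun μ hμ => eq_of_isInvariantProb hlim hμ⟩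

/-- A Feller kernel whose iterates converge weakly from one starting point leaves the
limit invariant. -/
theorem invariant_of_tendsto [HasOuterApproxClosed X] {R : Kernel X X} [IsMarkovKernel R]
    {m : Measure X} [IsProbabilityMeasure m]
    (hfeller : ∀ f : X →ᵇ ℝ, Continuous fun x => ∫ y, f y ∂(R x)) {x : X}
    (h : ∀ f : X →ᵇ ℝ, Tendsto (fun k => ∫ y, f y ∂((R ^ k) x)) atTop (𝓝 (∫ y, f y ∂m))) :
    R.Invariant m := by
  have : IsProbabilityMeasure (m.bind R) := inferInstance
  refine ext_of_forall_integral_eq_of_IsFiniteMeasure fun f => ?_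
  let g : X →ᵇ ℝ := BoundedContinuousFunction.ofNormedAddCommGroup
    (fun x => ∫ y, f y ∂(R x)) (hfeller f) ‖f‖ fun x => abs_integral_le_norm _ f
  have h1 : Tendsto (fun k => ∫ y, f y ∂((R ^ (k + 1)) x)) atTop (𝓝 (∫ y, g y ∂m)) := by
    simp_rw [integral_pow_succ]
    exact h g
  rw [integral_bind_kernel]
  exact tendsto_nhds_unique h1 ((h f).comp (tendsto_add_atTop_nat 1))

/-- Weak convergence of the invariant measures of uniformly geometrically ergodic kernels, and
existence and uniqueness of the invariant measure of the limiting kernel. -/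
theorem exists_isUniqueInvariantProb_tendsto [PolishSpace X] [Nonempty X] {V : X → ℝ}
    (hV : ∀ x, 1 ≤ V x) {Q : ℕ → Kernel X X} [∀ n, IsMarkovKernel (Q n)] {R : Kernel X X}
    [IsMarkovKernel R]
    (hequi : ∀ f : X →ᵇ ℝ, Equicontinuous fun (n : ℕ) (x : X) => ∫ y, f y ∂(Q n x))
    (hfeller : ∀ f : X →ᵇ ℝ, Continuous fun x => ∫ y, f y ∂(R x))
    (hconv : ∀ x, ∀ f : X →ᵇ ℝ,
      Tendsto (fun n => ∫ y, f y ∂(Q n x)) atTop (𝓝 (∫ y, f y ∂(R x))))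
    {K : ℝ} (hK : 1 ≤ K) (hQ : ∀ᶠ n in atTop, ergL V (Q n) < ENNReal.ofReal K) :
    ∃ m, IsUniqueInvariantProb R m ∧ ∀ f : X →ᵇ ℝ,
      Tendsto (fun n => ∫ y, f y ∂(invProb (Q n))) atTop (𝓝 (∫ y, f y ∂m)) := by
  let _ := TopologicalSpace.upgradeIsCompletelyMetrizable X
  set r : ℝ := 1 - K⁻¹ with hrdef
  have hKi : K⁻¹ ≤ 1 := inv_le_one_of_one_le₀ hK
  have hKp : 0 < K⁻¹ := by positivity
  have hr0 : 0 ≤ r := by linarith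
  have hr1 : r < 1 := by linarith
  have hpow := tendsto_integral_pow hequi hfeller hconv
  have hrlim : ∀ a b : ℝ, Tendsto (fun k : ℕ => a * (K * r ^ k * b)) atTop (𝓝 0) := fun a b => by
    simpa using
      (((tendsto_pow_atTop_nhds_zero_of_lt_one hr0 hr1).const_mul K).mul_const b).const_mul a
  have hbound : ∀ (f : X →ᵇ ℝ) (k l : ℕ) (x z : X),
      |∫ y, f y ∂((R ^ k) x) - ∫ y, f y ∂((R ^ l) z)|
        ≤ ‖f‖ * (K * r ^ k * V x + K * r ^ l * V z) := by
    intro f k l x z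
    -- For each large `n` both iterates of `Q n` are close to the same `invProb (Q n)`; the triangle
    -- inequality removes it before `n → ∞`.
    refine le_of_tendsto ((hpow k x f).sub (hpow l z f)).abs ?_
    filter_upwards [hQ] with n hn
    have h1 := abs_le.1 (abs_integral_pow_sub_invProb_le hV hK hn k x f)
    have h2 := abs_le.1 (abs_integral_pow_sub_invProb_le hV hK hn l z f)
    rw [mul_add, abs_le]
    constructor <;> linarith
  obtain ⟨x₀⟩ := ‹Nonempty X›
  have hV0 : ∀ x, 0 ≤ V x := fun x => zero_le_one.trans (hV x)
  -- The factor 2 covers the error terms at `k` and `l`, each at most the one at `N`.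
  obtain ⟨m, _, hm⟩ := exists_tendsto_measureReal (fun k => (R ^ k) x₀)
    (e := fun k => 2 * (K * r ^ k * V x₀)) (hrlim 2 (V x₀)) (by
      intro A hA k l N hk hl
      have hVx := hV0 x₀
      refine (abs_measureReal_sub_le_of_forall_integral (by positivity)
        (fun f => hbound f k l x₀ x₀) hA).trans ?_
      have hmono : ∀ j, N ≤ j → K * r ^ j * V x₀ ≤ K * r ^ N * V x₀ := fun j hj => by
        have := pow_le_pow_of_le_one hr0 hr1.le hj
        gcongr
      linarith [hmono k hk, hmono l hl])
  have hx₀ : ∀ f : X →ᵇ ℝ, Tendsto (fun k => ∫ y, f y ∂((R ^ k) x₀)) atTop (𝓝 (∫ y, f y ∂m)) :=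
    tendsto_integral_of_tendsto_measureReal hm
  have hall : ∀ x, ∀ f : X →ᵇ ℝ,
      Tendsto (fun k => ∫ y, f y ∂((R ^ k) x)) atTop (𝓝 (∫ y, f y ∂m)) := by
    intro x f
    have hsum : Tendsto (fun k : ℕ => ‖f‖ * (K * r ^ k * V x + K * r ^ k * V x₀)) atTop (𝓝 0) := by
      simpa [mul_add] using (hrlim ‖f‖ (V x)).add (hrlim ‖f‖ (V x₀))
    have hdist := squeeze_zero_norm
      (f := fun k => ∫ y, f y ∂((R ^ k) x) - ∫ y, f y ∂((R ^ k) x₀)) (fun k => hbound f k k x x₀) hsum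
    simpa using hdist.add (hx₀ f)
  refine ⟨m, ⟨⟨inferInstance, invariant_of_tendsto hfeller hx₀⟩,
    fun μ hμ => eq_of_isInvariantProb hall hμ⟩, fun f => ?_⟩
  -- Exchange of limits: as `k → ∞` the convergence is uniform over large `n`, and for fixed `k` the
  -- limit in `n` is `hpow`.
  refine TendstoUniformlyOnFilter.tendsto_of_eventually_tendsto (p := atTop)
    (F := fun k n => ∫ y, f y ∂((Q n ^ k) x₀)) ?_
    (Eventually.of_forall fun k => hpow k x₀ f) (hx₀ f)
  rw [Metric.tendstoUniformlyOnFilter_iff]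
  intro ε hε
  have hk := (hrlim ‖f‖ (V x₀)).eventually_lt_const hε
  filter_upwards [hk.prod_mk hQ] with p hp
  rw [dist_comm]
  exact (abs_integral_pow_sub_invProb_le hV hK hp.2 p.1 x₀ f).trans_lt hp.1

end InvariantMeasures

end AdaptiveMCMC

/-! ### The almost sure statement. -/

theorem theorem2p11
    {X : Type*} [TopologicalSpace X] [PolishSpace X] [MeasurableSpace X] [BorelSpace X]
    {Θ : Type*} [MeasurableSpace Θ]
    {Ω : Type*} [MeasurableSpace Ω] (Pr : Measure Ω) [IsProbabilityMeasure Pr]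
    (P : Θ → Kernel X X) [∀ t, IsMarkovKernel (P t)]
    (θ : ℕ → Ω → Θ) (hθ : ∀ n, Measurable (θ n))
    (π : Measure X) [SigmaFinite π] (hπ : π ≠ 0)
    (V : X → ℝ) (hA3 : AdaptiveMCMC.DriftMinorization π V P)
    (hL : ∀ᵐ ω ∂Pr, limsup (fun n => AdaptiveMCMC.ergL V (P (θ n ω))) atTop < ∞)
    (hequi : ∀ f : X →ᵇ ℝ, Equicontinuous (fun (t : Θ) (x : X) => ∫ y, f y ∂(P t x)))
    (θstar : Θ)
    (hconv : ∀ x : X, ∀ᵐ ω ∂Pr, ∀ f : X →ᵇ ℝ,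
      Tendsto (fun n => ∫ y, f y ∂(P (θ n ω) x)) atTop (𝓝 (∫ y, f y ∂(P θstar x)))) :
    AdaptiveMCMC.IsUniqueInvariantProb (P θstar) (AdaptiveMCMC.invProb (P θstar)) ∧
    ∃ Ω₀ : Set Ω, MeasurableSet Ω₀ ∧ Pr Ω₀ = 1 ∧ ∀ ω ∈ Ω₀,
      (∀ᶠ n in atTop, AdaptiveMCMC.IsUniqueInvariantProb (P (θ n ω))
        (AdaptiveMCMC.invProb (P (θ n ω)))) ∧
      ∀ f : X →ᵇ ℝ,
        Tendsto (fun n => ∫ y, f y ∂(AdaptiveMCMC.invProb (P (θ n ω)))) atTop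
          (𝓝 (∫ y, f y ∂(AdaptiveMCMC.invProb (P θstar)))) := by
  have hne : Nonempty X := by
    by_contra hX
    have := not_nonempty_iff.1 hX
    exact hπ (Measure.eq_zero_of_isEmpty π)
  have hV := hA3.one_le_V
  have hfeller : ∀ t, ∀ f : X →ᵇ ℝ, Continuous fun x => ∫ y, f y ∂(P t x) := fun t f =>
    (hequi f).continuous t
  have hconv' : ∀ᵐ ω ∂Pr, ∀ x : X, ∀ f : X →ᵇ ℝ,
      Tendsto (fun n => ∫ y, f y ∂(P (θ n ω) x)) atTop (𝓝 (∫ y, f y ∂(P θstar x))) := by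
    -- The exceptional null set in `hconv` depends on `x`. A countable dense set of points needs
    -- only one null set, and equicontinuity makes the set of points of convergence closed.
    obtain ⟨S, hSc, hSd⟩ := TopologicalSpace.exists_countable_dense X
    filter_upwards [(ae_ball_iff hSc).2 fun x _ => hconv x] with ω hω x f
    have hcl := ((hequi f).comp fun n => θ n ω).isClosed_setOfPred_tendsto (l := atTop)
      (hfeller θstar f)
    exact hcl.closure_subset_iff.2 (fun x hx => hω x hx f) (hSd x)
  have hgood : ∀ᵐ ω ∂Pr,
      (∀ᶠ n in atTop, AdaptiveMCMC.IsUniqueInvariantProb (P (θ n ω))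
        (AdaptiveMCMC.invProb (P (θ n ω)))) ∧
      ∃ m, AdaptiveMCMC.IsUniqueInvariantProb (P θstar) m ∧ ∀ f : X →ᵇ ℝ,
        Tendsto (fun n => ∫ y, f y ∂(AdaptiveMCMC.invProb (P (θ n ω)))) atTop
          (𝓝 (∫ y, f y ∂m)) := by
    filter_upwards [hconv', hL] with ω hω hLω
    -- The bound may depend on `ω`, as the argument is pathwise.
    obtain ⟨K₀, hK₀, hlt⟩ := exists_between hLω
    have hev : ∀ᶠ n in atTop,
        AdaptiveMCMC.ergL V (P (θ n ω)) < ENNReal.ofReal (max 1 K₀.toReal) := by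
      filter_upwards [eventually_lt_of_limsup_lt hK₀] with n hn
      refine hn.trans_le ?_
      rw [← ENNReal.ofReal_toReal hlt.ne, ENNReal.toReal_ofReal ENNReal.toReal_nonneg]
      exact ENNReal.ofReal_le_ofReal (le_max_right _ _)
    exact ⟨hev.mono fun n hn =>
        AdaptiveMCMC.isUniqueInvariantProb_invProb hV (le_max_left _ _) hn,
      AdaptiveMCMC.exists_isUniqueInvariantProb_tendsto hV
        (fun f => (hequi f).comp fun n => θ n ω) (hfeller θstar) hω (le_max_left _ _) hev⟩
  -- The kernel at `θstar` is not random, so one good `ω` settles existence and uniqueness for it.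
  obtain ⟨ω, -, m, hm, -⟩ := hgood.exists
  have hmeq := hm.invProb_eq
  refine ⟨hmeq ▸ hm, ?_⟩
  obtain ⟨S, hSae, hSmeas, hS⟩ := hgood.exists_measurable_mem
  refine ⟨S, hSmeas, (prob_compl_eq_zero_iff hSmeas).1 hSae, fun ω hω => ⟨(hS ω hω).1, ?_⟩⟩
  obtain ⟨m', hm', hlim⟩ := (hS ω hω).2
  rwa [hm'.invProb_eq]
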